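/- Let $C$ be a commutative $\mathbb{C}$-algebra and let $B$ be an Azumaya algebra over $C$ together with a $\mathbb{C}$-algebra map $\iota:\mathbb{C}^k\to B$. Let $\alpha=(d_1,\dots,d_k)$ be a tuple of positive integers, put $n=\sum_i d_i$, and suppose that $B$ has dimension vector $\alpha$: there are a faithfully flat étale extension $C\to D$ and an isomorphism of $D$-algebras $D\otimes_C B\cong M_n(D)$ under which $\iota$ becomes the diagonal embedding $(z_1,\dots,z_k)\mapsto\mathrm{diag}(z_1,\dots,z_1,\dots,z_k,\dots,z_k)$, with $z_i$ repeated $d_i$ times. Let $\mathrm{Out}_C(B)$ be the group of $C$-algebra automorphisms of $B$ modulo the inner ones $b\mapsto ubu^{-1}$ ($u\in B^\times$). Then $\varphi\mapsto (B_\varphi)^B=\{b\in B : b\,\varphi(x)=xb \text{ for all } x\in B\}$ induces an injective group homomorphism from $\mathrm{Out}_C(B)$ to the Picard group $\mathrm{Pic}(C)$; thus $\mathrm{Out}_C(B)\subseteq\mathrm{Pic}(C)$. Moreover, if $\psi$ is a $\mathbb{C}^k$-linear automorphism of $B$, that is, a $C$-algebra automorphism with $\psi(\iota(z))=\iota(z)$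 for all $z\in\mathbb{C}^k$, then the class of $\psi$ in $\mathrm{Out}_C(B)$ has finite order, and this order divides $\gcd(d_1,\dots,d_k)$. In particular, if $\gcd(d_1,\dots,d_k)=1$, then every such $\psi$ is inner. -/

import Mathlib

open scoped TensorProduct

namespace AzumayaDim

universe u v

section Out

variable (C : Type u) (B : Type v) [CommRing C] [Ring B] [Algebra C B]

/-- The homomorphism `Bˣ → Aut_C(B)` sending a unit `u` to the conjugation `b ↦ u * b * u⁻¹`. -/
def conjHom : Bˣ →* (B ≃ₐ[C] B) :=
  (MulSemiringAction.toAlgAut (ConjAct Bˣ) C B).comp ConjAct.toConjAct.toMonoidHom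

theorem conjHom_apply (w : Bˣ) (b : B) : conjHom C B w b = w * b * (w⁻¹ : Bˣ) := rfl

/-- The group of inner automorphisms of `B`. -/
def Inn : Subgroup (B ≃ₐ[C] B) := (conjHom C B).range

instance Inn_normal : (Inn C B).Normal := by
  refine ⟨?_⟩
  rintro _ ⟨w, rfl⟩ g
  refine ⟨Units.map (g : B →* B) w, ?_⟩
  ext b
  have hb : g (g⁻¹ b) = b := g.apply_symm_apply b
  simp only [AlgEquiv.mul_apply, conjHom_apply, map_mul, hb]
  rfl

/-- `Out_C(B)`: the `C`-linear algebra automorphisms of `B` modulo the inner ones. -/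
abbrev Out : Type v := (B ≃ₐ[C] B) ⧸ Inn C B

variable {C B}

/-- Let `B_φ` be the `B`-bimodule equal to `B` as a left module and with right action
`b · x := b * φ x`. This is the `C`-module `(B_φ)^B` of its central elements, that is, of the
`b` with `b · x = x * b` for all `x` in `B`. -/
def twistedCenter (φ : B ≃ₐ[C] B) : Submodule C B where
  carrier := {b | ∀ x, b * φ x = x * b}
  add_mem' {a b} ha hb x := by rw [add_mul, mul_add, ha x, hb x]
  zero_mem' x := by rw [zero_mul, mul_zero]
  smul_mem' c b hb x := by rw [Algebra.smul_mul_assoc, hb x, Algebra.mul_smul_comm]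

end Out

/-- The Azumaya algebra `B` over `C`, with the distinguished map `ι : ℂ^k → B`, has dimension
vector `d = (d_1, …, d_k)`: there are an étale cover `C → D` (étale and faithfully flat) and an
isomorphism of `D`-algebras from `D ⊗[C] B` to the algebra `M_n(D)`, `n = ∑ i, d_i`, whose
rows and columns are grouped into `k` blocks of sizes `d_1, …, d_k`, under which `ι` becomes the
diagonal embedding `z ↦ diag(z_1, …, z_1, …, z_k, …, z_k)` with `z_i` repeated `d_i` times. -/
def HasDimensionVector (C : Type u) (B : Type v) [CommRing C] [Algebra ℂ C] [Ring B]
    [Algebra C B] [Algebra ℂ B] [IsScalarTower ℂ C B] {k : ℕ} (d : Fin k → ℕ)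
    (ι : (Fin k → ℂ) →ₐ[ℂ] B) : Prop :=
  ∃ (D : Type u) (_ : CommRing D) (_ : Algebra C D),
    Algebra.Etale C D ∧ Module.FaithfullyFlat C D ∧
    ∃ f : (D ⊗[C] B) ≃ₐ[D] Matrix (Σ i, Fin (d i)) (Σ i, Fin (d i)) D,
      ∀ z : Fin k → ℂ, f (1 ⊗ₜ[C] ι z) =
        Matrix.diagonal (fun p => algebraMap C D (algebraMap ℂ C (z p.1)))

end AzumayaDim

/-! Write `I φ` for `twistedCenter φ`. As `B ⊗ Bᵐᵒᵖ ≅ End_C(B)`, every twisted bimodule is generated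
by its central elements (`top_mul_twistedCenter`). Together with Nakayama this makes `I φ` an
invertible submodule of `B` with `I φ * I χ = I (χ * φ)`. Its class in `Pic C` is trivial exactly
when a unit of `B` generates `I φ`, that is, when `φ` is inner.

For the torsion, let `e` be the image of the `i`-th idempotent. If `ψ` fixes `e`, elements of `I ψ`
commute with `e`, so over the étale cover they have a determinant on the `i`-th block. This is a
norm of degree `d i`, and it trivialises the `d i`-th power of `I ψ` (`pow_mem_Inn_of_norm`). Its
values lie in `C` because traces do, and in characteristic zero Newton's identities recover the
determinant from traces of powers. -/

section Matrix

open Polynomial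

/-! ### Determinants from traces of powers -/

namespace Matrix

variable {R m : Type*} [CommRing R] [Fintype m] [DecidableEq m]

/-- Jacobi's formula for matrices of polynomials. -/
theorem derivative_det_eq_trace_adjugate_mul (M : Matrix m m R[X]) :
    derivative M.det = trace (M.adjugate * M.map derivative) := by
  have h : ∀ i, (M.adjugate * M.map derivative) i i =
      (M.updateCol i fun j => derivative (M j i)).det := by
    intro i
    rw [← cramer_apply, cramer_eq_adjugate_mulVec]
    rfl
  simp only [trace, diag_apply, h, det_apply, derivative_sum, derivative_smul]
  rw [Finset.sum_comm]
  refine Finset.sum_congr rfl fun σ _ => ?_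
  rw [← Finset.smul_sum, derivative_prod_finset]
  congr 1
  refine Finset.sum_congr rfl fun i _ => ?_
  rw [← Finset.mul_prod_erase _ _ (Finset.mem_univ i), mul_comm]
  congr 1
  · simp
  · refine Finset.prod_congr rfl fun j hj => ?_
    rw [updateCol_ne (Finset.ne_of_mem_erase hj)]

/-- If a subring contains the traces of all powers of a matrix and is closed under division by
positive integers, then it contains the coefficients of the reversed characteristic polynomial. -/
theorem coeff_charpolyRev_mem (S : Subring R) (A : Matrix m m R)
    (hS : ∀ (k : ℕ) (x : R), (k + 1 : R) * x ∈ S → x ∈ S)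
    (hA : ∀ k : ℕ, trace (A ^ k) ∈ S) (k : ℕ) : A.charpolyRev.coeff k ∈ S := by
  set M : Matrix m m R[X] := 1 - (X : R[X]) • A.map C with hM
  -- As a power series, `s j` is `A.charpolyRev * ∑ i, trace (A ^ (i + j)) * X ^ i`, since `M` is
  -- inverse to `∑ i, A ^ i * X ^ i`.
  let s : ℕ → R[X] := fun j => trace (M.adjugate * (A ^ j).map C)
  have hp : A.charpolyRev = M.det := rfl
  have hs : ∀ j, s j = A.charpolyRev * C (trace (A ^ j)) + X * s (j + 1) := by
    intro j
    have hpow : (A ^ (j + 1)).map C = A.map C * (A ^ j).map (C : R →+* R[X]) := by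
      rw [pow_succ', Matrix.map_mul]
    have h1 : M.adjugate * (M * (A ^ j).map C) = A.charpolyRev • (A ^ j).map C := by
      rw [← Matrix.mul_assoc, adjugate_mul, hp, Matrix.smul_mul, Matrix.one_mul]
    have h2 : M * (A ^ j).map C = (A ^ j).map C - (X : R[X]) • (A ^ (j + 1)).map C := by
      rw [hM, Matrix.sub_mul, Matrix.one_mul, Matrix.smul_mul, hpow]
    have h3 := congrArg trace h1
    rw [h2, Matrix.mul_sub, Matrix.mul_smul, trace_sub, trace_smul, trace_smul] at h3
    have h4 : trace ((A ^ j).map (C : R →+* R[X])) = C (trace (A ^ j)) := by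
      simp [trace]
    rw [h4, smul_eq_mul, smul_eq_mul] at h3
    exact sub_eq_iff_eq_add.mp h3
  have hd : derivative A.charpolyRev = - s 1 := by
    have h : M.map derivative = -(A.map C) := by
      ext i j : 2
      simp [hM, Matrix.one_apply, apply_ite]
    rw [hp, derivative_det_eq_trace_adjugate_mul, h, Matrix.mul_neg, trace_neg]
    simp [s]
  have main : ∀ k, A.charpolyRev.coeff k ∈ S ∧ ∀ j, (s j).coeff k ∈ S := by
    intro k
    induction k with
    | zero =>
      have h0 : A.charpolyRev.coeff 0 = 1 := by rw [coeff_zero_eq_eval_zero, eval_charpolyRev]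
      refine ⟨h0 ▸ S.one_mem, fun j => ?_⟩
      rw [hs, coeff_add, coeff_mul_C, mul_coeff_zero, coeff_X_zero, zero_mul, add_zero, h0, one_mul]
      exact hA j
    | succ k ih =>
      have h1 : A.charpolyRev.coeff (k + 1) ∈ S := by
        refine hS k _ ?_
        have := congrArg (fun q => coeff q k) hd
        simp only [coeff_derivative, coeff_neg] at this
        rw [mul_comm, this]
        exact S.neg_mem (ih.2 1)
      refine ⟨h1, fun j => ?_⟩
      rw [hs, coeff_add, coeff_mul_C, coeff_X_mul]
      exact S.add_mem (S.mul_mem h1 (hA j)) (ih.2 _)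
  exact (main k).1

theorem det_mem_of_trace_pow_mem (S : Subring R) (A : Matrix m m R)
    (hS : ∀ (k : ℕ) (x : R), (k + 1 : R) * x ∈ S → x ∈ S)
    (hA : ∀ k : ℕ, trace (A ^ k) ∈ S) : A.det ∈ S := by
  nontriviality R
  have h := coeff_charpolyRev_mem S A hS hA (Fintype.card m)
  rw [← reverse_charpoly, coeff_reverse, charpoly_natDegree_eq_dim, revAt_le le_rfl,
    Nat.sub_self] at h
  rw [det_eq_sign_charpoly_coeff]
  exact S.mul_mem (S.pow_mem (S.neg_mem S.one_mem) _) h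

theorem trace_mulLeft (A : Matrix m m R) :
    LinearMap.trace R (Matrix m m R) (LinearMap.mulLeft R A) = Fintype.card m * A.trace := by
  rw [LinearMap.trace_eq_matrix_trace R (Matrix.stdBasis R m m)]
  simp only [trace, diag_apply, LinearMap.toMatrix_apply, Fintype.sum_prod_type]
  have h : ∀ i j : m, (Matrix.stdBasis R m m).repr
      (LinearMap.mulLeft R A (Matrix.stdBasis R m m (i, j))) (i, j) = A i i := by
    intro i j
    rw [stdBasis_eq_single]
    have : ∀ (N : Matrix m m R), (Matrix.stdBasis R m m).repr N (i, j) = N i j := fun N => by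
      simp [Matrix.stdBasis]
    rw [this, LinearMap.mulLeft_apply]
    simp
  simp only [h, Finset.sum_const, Finset.card_univ, nsmul_eq_mul, Finset.mul_sum]

end Matrix

end Matrix

/-! ### Traces under base change -/

section Trace

open Module

variable {C D : Type*} [CommRing C] [CommRing D] [Algebra C D]

/-- The trace of a base change of an endomorphism of a finite projective module. -/
theorem LinearMap.trace_baseChange_mem_range {P : Type*} [AddCommGroup P] [Module C P]
    [Module.Finite C P] [Module.Projective C P] [Module.Free D (D ⊗[C] P)] (g : P →ₗ[C] P) :
    LinearMap.trace D (D ⊗[C] P) (g.baseChange D) ∈ (algebraMap C D).range := by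
  -- As `P` is finite projective, `g` is a sum of rank-one maps `q ↦ l q • p`, each with trace `l
  -- p`.
  obtain ⟨t, rfl⟩ := (dualTensorHomEquiv C P P).surjective g
  induction t with
  | zero => simp
  | add x y hx hy =>
    rw [map_add, LinearMap.baseChange_add, map_add]
    exact add_mem hx hy
  | tmul l p =>
    have : ((dualTensorHomEquiv C P P) (l ⊗ₜ p)).baseChange D =
        (Dual.baseChange D l).smulRight (1 ⊗ₜ p) := by
      ext q
      simp [TensorProduct.smul_tmul']
    rw [this, LinearMap.trace_smulRight]
    simp [Dual.baseChange_apply_tmul, Algebra.algebraMap_eq_smul_one]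

end Trace

namespace AzumayaDim

open Module Submodule

variable {C B : Type*} [CommRing C] [Ring B] [Algebra C B]

theorem mem_twistedCenter {φ : B ≃ₐ[C] B} {b : B} :
    b ∈ twistedCenter φ ↔ ∀ x, b * φ x = x * b := Iff.rfl

theorem mul_mem_twistedCenter {φ χ : B ≃ₐ[C] B} {a b : B} (ha : a ∈ twistedCenter φ)
    (hb : b ∈ twistedCenter χ) : a * b ∈ twistedCenter (χ * φ) := fun x => by
  rw [AlgEquiv.mul_apply, mul_assoc, hb (φ x), ← mul_assoc, ha x, mul_assoc]

theorem pow_mem_twistedCenter {φ : B ≃ₐ[C] B} {a : B} (ha : a ∈ twistedCenter φ) (n : ℕ) :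
    a ^ n ∈ twistedCenter (φ ^ n) := by
  induction n with
  | zero => intro x; simp
  | succ n ih => rw [pow_succ', pow_succ]; exact mul_mem_twistedCenter ih ha

theorem twistedCenter_mul_le (φ χ : B ≃ₐ[C] B) :
    twistedCenter φ * twistedCenter χ ≤ twistedCenter (χ * φ) :=
  Submodule.mul_le.mpr fun _ ha _ hb => mul_mem_twistedCenter ha hb

/-- A consequence of Nakayama's lemma for faithful finite modules. -/
theorem ideal_eq_top_of_top_le_smul_top [FaithfulSMul C B] [Module.Finite C B] (I : Ideal C)
    (h : (⊤ : Submodule C B) ≤ I • ⊤) : I = ⊤ := by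
  obtain ⟨r, hr, hr0⟩ := exists_sub_one_mem_and_smul_eq_zero_of_fg_of_le_smul I ⊤
    Module.Finite.fg_top h
  have : r = 0 := FaithfulSMul.eq_of_smul_eq_smul (α := B) fun b => by
    rw [hr0 b mem_top, zero_smul]
  rw [this, zero_sub, neg_mem_iff] at hr
  exact (Ideal.eq_top_iff_one I).mpr hr

theorem eq_one_of_top_mul_eq_top [FaithfulSMul C B] [Module.Finite C B] {J : Submodule C B}
    (hJ : J ≤ 1) (h : ⊤ * J = ⊤) : J = 1 := by
  have hI := ideal_eq_top_of_top_le_smul_top (B := B) (J.comap (Algebra.linearMap C B)) <| by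
    refine h.ge.trans (Submodule.mul_le.mpr ?_)
    intro b _ j hj
    obtain ⟨c, rfl⟩ := mem_one.mp (hJ hj)
    rw [← Algebra.commutes, ← Algebra.smul_def]
    exact smul_mem_smul hj mem_top
  refine le_antisymm hJ (one_le.mpr ?_)
  simpa using (Ideal.eq_top_iff_one _).mp hI

/-! ### Twisted bimodules and the Picard group -/

section Bimodule

/-- The `B ⊗ Bᵐᵒᵖ`-action on the bimodule equal to `B` as a left module and with right action
`b · x := b * φ x`. -/
def twistedAction (φ : B ≃ₐ[C] B) : B ⊗[C] Bᵐᵒᵖ →ₐ[C] Module.End C B :=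
  (AlgHom.mulLeftRight C B).comp (Algebra.TensorProduct.map (AlgHom.id C B) φ.toAlgHom.op)

theorem twistedAction_tmul (φ : B ≃ₐ[C] B) (x : B) (y : Bᵐᵒᵖ) (m : B) :
    twistedAction φ (x ⊗ₜ y) m = x * m * φ y.unop := by
  simp [twistedAction]

variable [IsAzumaya C B]

/-- The element of `B ⊗ Bᵐᵒᵖ` that acts on `B` as the endomorphism `b ↦ l b • 1`. -/
noncomputable def scalarElement (l : Dual C B) : B ⊗[C] Bᵐᵒᵖ :=
  (Equiv.ofBijective _ (IsAzumaya.AlgHom.mulLeftRight_bij C B)).symm (l.smulRight 1)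

theorem mulLeftRight_scalarElement (l : Dual C B) :
    AlgHom.mulLeftRight C B (scalarElement l) = l.smulRight 1 :=
  (Equiv.ofBijective _ (IsAzumaya.AlgHom.mulLeftRight_bij C B)).apply_symm_apply _

/-- Both sides act on `B` as `b ↦ l b • z`. Being an identity in `B ⊗ Bᵐᵒᵖ`, it can be transported
to any twisted action. -/
theorem tmul_one_mul_scalarElement (l : Dual C B) (z : B) :
    (z ⊗ₜ[C] (1 : Bᵐᵒᵖ)) * scalarElement l = (1 ⊗ₜ MulOpposite.op z) * scalarElement l := by
  apply (IsAzumaya.AlgHom.mulLeftRight_bij C B).1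
  ext b
  simp [mulLeftRight_scalarElement]

theorem twistedAction_scalarElement_mem (φ : B ≃ₐ[C] B) (l : Dual C B) (m : B) :
    twistedAction φ (scalarElement l) m ∈ twistedCenter φ := fun x => by
  have h := congrArg (fun t => twistedAction φ t m) (tmul_one_mul_scalarElement l x)
  simpa [twistedAction_tmul] using h.symm

/-- A dual basis of `B` decomposes the identity of `End_C(B)`, hence `1` in `B ⊗ Bᵐᵒᵖ`. Acting on a
twisted bimodule, this writes each element as a sum of `b i` times central elements. -/
theorem exists_sum_scalarElement (C B : Type*) [CommRing C] [Ring B] [Algebra C B]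
    [IsAzumaya C B] : ∃ (n : ℕ) (b : Fin n → B) (l : Fin n → Dual C B),
      (∀ m, ∑ i, l i m • b i = m) ∧ ∑ i, (b i ⊗ₜ[C] (1 : Bᵐᵒᵖ)) * scalarElement (l i) = 1 := by
  obtain ⟨n, f, g, -, -, hfg⟩ := Module.Finite.exists_comp_eq_id_of_projective C B
  have hsum (m : B) : ∑ i, (LinearMap.proj i ∘ₗ g) m • f (Pi.single i 1) = m := by
    conv_rhs => rw [← LinearMap.id_apply (R := C) m, ← hfg, LinearMap.comp_apply,
      pi_eq_sum_univ' (g m), map_sum]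
    simp
  refine ⟨n, fun i => f (Pi.single i 1), fun i => LinearMap.proj i ∘ₗ g, hsum, ?_⟩
  apply (IsAzumaya.AlgHom.mulLeftRight_bij C B).1
  ext m
  simpa [mulLeftRight_scalarElement, LinearMap.sum_apply] using hsum m

theorem top_mul_twistedCenter (φ : B ≃ₐ[C] B) : ⊤ * twistedCenter φ = ⊤ := by
  refine top_unique fun m _ => ?_
  obtain ⟨n, b, l, -, h⟩ := exists_sum_scalarElement C B
  have hm := congrArg (fun t => twistedAction φ t m) h
  simp only [map_sum, map_mul, map_one, LinearMap.sum_apply, Module.End.mul_apply,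
    twistedAction_tmul, Module.End.one_apply, MulOpposite.unop_one, mul_one] at hm
  rw [← hm]
  exact sum_mem fun i _ => mul_mem_mul mem_top (twistedAction_scalarElement_mem φ _ m)

theorem exists_dual_apply_one (C B : Type*) [CommRing C] [Ring B] [Algebra C B]
    [IsAzumaya C B] : ∃ l : Dual C B, l 1 = 1 := by
  obtain ⟨n, b, l, h, -⟩ := exists_sum_scalarElement C B
  -- The values `l 1` form an ideal; expanding `1` in a dual basis shows that it generates `B`.
  have hI := ideal_eq_top_of_top_le_smul_top (B := B)
    (LinearMap.range (LinearMap.applyₗ (R := C) (M₂ := C) (1 : B))) fun m _ => by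
      have hm := congrArg (· * m) (h 1)
      simp only [Finset.sum_mul, one_mul] at hm
      rw [← hm]
      refine sum_mem fun i _ => ?_
      rw [smul_mul_assoc]
      exact smul_mem_smul ⟨l i, rfl⟩ mem_top
  exact (Ideal.eq_top_iff_one _).mp hI

/-- The center of an Azumaya algebra consists of the scalars. -/
theorem twistedCenter_one : twistedCenter (1 : B ≃ₐ[C] B) = 1 := by
  refine le_antisymm (fun z hz => ?_) (one_le.mpr fun x => by simp)
  obtain ⟨l, hl⟩ := exists_dual_apply_one C B
  -- Multiplication by the central element `z` commutes with the bimodule action; `scalarElement l`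
  -- then gives `l z • 1 = z`.
  have key : ∀ t : B ⊗[C] Bᵐᵒᵖ,
      AlgHom.mulLeftRight C B t z = AlgHom.mulLeftRight C B t 1 * z := by
    intro t
    induction t with
    | zero => simp
    | add x y hx hy => simp only [map_add, LinearMap.add_apply, hx, hy, add_mul]
    | tmul x y =>
      have : z * y.unop = y.unop * z := hz y.unop
      simp [mul_assoc, this]
  have h := key (scalarElement l)
  simp only [mulLeftRight_scalarElement, LinearMap.smulRight_apply, hl, one_smul, one_mul] at h
  exact mem_one.mpr ⟨l z, by rw [Algebra.algebraMap_eq_smul_one, h]⟩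

theorem twistedCenter_mul_eq_one {φ χ : B ≃ₐ[C] B} (h : χ * φ = 1) :
    twistedCenter φ * twistedCenter χ = 1 := by
  refine eq_one_of_top_mul_eq_top ((twistedCenter_mul_le φ χ).trans ?_) ?_
  · rw [h, twistedCenter_one]
  · rw [← mul_assoc, top_mul_twistedCenter, top_mul_twistedCenter]

/-- `twistedCenter φ` as an invertible submodule of `B`. -/
def twistedCenterUnit (φ : B ≃ₐ[C] B) : (Submodule C B)ˣ where
  val := twistedCenter φ
  inv := twistedCenter φ⁻¹
  val_inv := twistedCenter_mul_eq_one (inv_mul_cancel φ)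
  inv_val := twistedCenter_mul_eq_one (mul_inv_cancel φ)

theorem twistedCenter_mul (φ χ : B ≃ₐ[C] B) :
    twistedCenter φ * twistedCenter χ = twistedCenter (χ * φ) := by
  refine le_antisymm (twistedCenter_mul_le φ χ) ?_
  calc twistedCenter (χ * φ)
      = twistedCenter φ * (twistedCenter φ⁻¹ * twistedCenter (χ * φ)) := by
        rw [← mul_assoc, twistedCenter_mul_eq_one (inv_mul_cancel φ), one_mul]
    _ ≤ twistedCenter φ * twistedCenter χ := by
        refine mul_le_mul' le_rfl ((twistedCenter_mul_le _ _).trans_eq ?_)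
        rw [mul_assoc, mul_inv_cancel, mul_one]

omit [IsAzumaya C B] in
theorem mem_Inn_of_isUnit_mem_twistedCenter {φ : B ≃ₐ[C] B} {w : B} (hw : IsUnit w)
    (h : w ∈ twistedCenter φ) : φ ∈ Inn C B := by
  obtain ⟨u, rfl⟩ := hw
  refine ⟨u⁻¹, AlgEquiv.ext fun x => ?_⟩
  rw [conjHom_apply, mul_assoc, inv_inv, ← h x, Units.inv_mul_cancel_left]

theorem twistedCenter_conjHom (u : Bˣ) :
    twistedCenter (conjHom C B u) = span C {((u⁻¹ : Bˣ) : B)} := by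
  refine le_antisymm (fun b hb => ?_) ?_
  · have hc : b * u ∈ twistedCenter (1 : B ≃ₐ[C] B) := fun x => by
      have := hb x
      rw [conjHom_apply, ← mul_assoc, ← mul_assoc] at this
      rw [AlgEquiv.one_apply, ← mul_assoc, ← this, Units.inv_mul_cancel_right]
    rw [twistedCenter_one] at hc
    obtain ⟨c, hc⟩ := mem_one.mp hc
    refine mem_span_singleton.mpr ⟨c, ?_⟩
    rw [Algebra.smul_def, hc, Units.mul_inv_cancel_right]
  · rw [span_singleton_le_iff_mem]
    intro x
    rw [conjHom_apply, ← mul_assoc, ← mul_assoc, Units.inv_mul, one_mul]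

variable (C B) in
/-- The homomorphism `φ ↦ twistedCenter φ` from automorphisms to the Picard group. -/
noncomputable def autToPic : (B ≃ₐ[C] B) →* CommRing.Pic C where
  toFun φ := unitsToPic C B (twistedCenterUnit φ)
  map_one' := by
    rw [show twistedCenterUnit (1 : B ≃ₐ[C] B) = 1 from Units.ext twistedCenter_one, map_one]
  map_mul' φ χ := by
    -- Commutativity of `Pic C` absorbs the reversed order in `twistedCenter_mul`.
    rw [mul_comm, ← map_mul]
    exact congrArg _ (Units.ext (twistedCenter_mul χ φ).symm)

theorem ker_autToPic : (autToPic C B).ker = Inn C B := by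
  ext φ
  change twistedCenterUnit φ ∈ (unitsToPic C B).ker ↔ _
  rw [ker_unitsToPic]
  constructor
  · rintro ⟨w, hw⟩
    refine mem_Inn_of_isUnit_mem_twistedCenter w.isUnit ?_
    have : span C {(w : B)} = twistedCenter φ := congrArg Units.val hw
    exact this ▸ mem_span_singleton_self _
  · rintro ⟨u, rfl⟩
    exact ⟨u⁻¹, Units.ext (twistedCenter_conjHom u).symm⟩

variable (C B) in
/-- The homomorphism from outer automorphisms to the Picard group. -/
noncomputable def outToPic : Out C B →* CommRing.Pic C :=
  QuotientGroup.lift (Inn C B) (autToPic C B) ker_autToPic.ge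

theorem outToPic_injective : Function.Injective (outToPic C B) :=
  (QuotientGroup.injective_lift_iff _ _ ker_autToPic.ge).mpr ker_autToPic.symm

end Bimodule

end AzumayaDim

namespace AzumayaDim

open Module Submodule

/-! ### The reduced norm -/

section Norm

variable {C B D : Type*} [CommRing C] [Ring B] [Algebra C B] [CommRing D] [Algebra C D]
  {m : Type*} [Fintype m] [DecidableEq m]

variable [Module.Finite C B] [Module.Projective C B]

/-- This is the trace of left multiplication by `b`, an endomorphism already defined over `C`. -/
theorem card_mul_trace_mem_range (f : (D ⊗[C] B) ≃ₐ[D] Matrix m m D) (b : B) :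
    (Fintype.card m : D) * (f (1 ⊗ₜ b)).trace ∈ (algebraMap C D).range := by
  have : Module.Free D (D ⊗[C] B) := Module.Free.of_equiv f.symm.toLinearEquiv
  have h : f.toLinearEquiv.conj ((LinearMap.mulLeft C b).baseChange D) =
      LinearMap.mulLeft D (f (1 ⊗ₜ b)) := by
    ext1 M
    obtain ⟨x, rfl⟩ := f.surjective M
    have : (LinearMap.mulLeft C b).baseChange D x = (1 ⊗ₜ b) * x := by
      induction x with
      | zero => simp
      | add x y hx hy => rw [map_add, hx, hy, mul_add]
      | tmul d y => simp
    simp [LinearEquiv.conj_apply, this]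
  rw [← Matrix.trace_mulLeft, ← h, LinearMap.trace_conj']
  exact LinearMap.trace_baseChange_mem_range _

/-- The reduced norm of a form of a matrix algebra over a `ℚ`-algebra takes values in the base. -/
theorem det_mem_range [Algebra ℚ C] [Nonempty m] (f : (D ⊗[C] B) ≃ₐ[D] Matrix m m D) (b : B) :
    (f (1 ⊗ₜ b)).det ∈ (algebraMap C D).range := by
  have hdiv : ∀ (n : ℕ) (x : D), (n + 1 : D) * x ∈ (algebraMap C D).range →
      x ∈ (algebraMap C D).range := by
    rintro n x ⟨c, hc⟩
    refine ⟨algebraMap ℚ C (n + 1)⁻¹ * c, ?_⟩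
    have hn : algebraMap ℚ C (n + 1)⁻¹ * (n + 1) = 1 := by
      have : ((n : ℚ) + 1)⁻¹ * (n + 1) = 1 := inv_mul_cancel₀ (by positivity)
      simpa using congrArg (algebraMap ℚ C) this
    have hn' := congrArg (algebraMap C D) hn
    rw [map_mul, hc, ← mul_assoc]
    simp only [map_mul, map_add, map_natCast, map_one] at hn' ⊢
    rw [hn', one_mul]
  refine Matrix.det_mem_of_trace_pow_mem _ _ hdiv fun k => ?_
  obtain ⟨n, hn⟩ := Nat.exists_eq_succ_of_ne_zero (Fintype.card_ne_zero (α := m))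
  refine hdiv n _ ?_
  have h := card_mul_trace_mem_range f (b ^ k)
  rw [hn, Nat.cast_succ] at h
  rwa [← map_pow, Algebra.TensorProduct.tmul_pow, one_pow]

end Norm

/-! ### A norm bounds the order -/

section Torsion

variable {C B : Type*} [CommRing C] [Ring B] [Algebra C B] [IsAzumaya C B]

theorem mul_eq_one_symm_of_finite {C B : Type*} [CommRing C] [Ring B] [Algebra C B]
    [Module.Finite C B] {u v : B} (h : u * v = 1) : v * u = 1 := by
  have hs : Function.Surjective (LinearMap.mulLeft C u) := fun x =>
    ⟨v * x, by rw [LinearMap.mulLeft_apply, ← mul_assoc, h, one_mul]⟩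
  refine OrzechProperty.injective_of_surjective_endomorphism _ hs ?_
  simp [← mul_assoc, h]

theorem pow_mul_pow_of_mul_eq_algebraMap {C B : Type*} [CommRing C] [Ring B] [Algebra C B]
    {a b : B} {c : C} (h : a * b = algebraMap C B c) (n : ℕ) :
    a ^ n * b ^ n = algebraMap C B c ^ n := by
  induction n with
  | zero => simp
  | succ n ih =>
    rw [pow_succ a, pow_succ' b, mul_assoc, ← mul_assoc a b, h, Algebra.left_comm, ih, pow_succ']

/-- If `twistedCenter φ` carries a norm that is multiplicative of degree `n`, then `φ ^ n` is
inner. -/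
theorem pow_mem_Inn_of_norm (φ : B ≃ₐ[C] B) (n : ℕ) (N : B → C)
    (hN : ∀ a ∈ twistedCenter φ, ∀ b ∈ twistedCenter φ⁻¹, ∀ c : C,
      a * b = algebraMap C B c → N a * N b = c ^ n) : φ ^ n ∈ Inn C B := by
  have hmul : twistedCenter φ * twistedCenter φ⁻¹ = 1 :=
    twistedCenter_mul_eq_one (inv_mul_cancel φ)
  let S : Set C := {c | ∃ a ∈ twistedCenter φ, ∃ b ∈ twistedCenter φ⁻¹, a * b = algebraMap C B c}
  have hprod : ∀ a ∈ twistedCenter φ, ∀ b ∈ twistedCenter φ⁻¹, ∃ c, algebraMap C B c = a * b :=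
    fun a ha b hb => mem_one.mp (hmul ▸ mul_mem_mul ha hb)
  have hS : Ideal.span S = ⊤ := by
    have hle : twistedCenter φ * twistedCenter φ⁻¹ ≤
        Submodule.map (Algebra.linearMap C B) (Ideal.span S) := Submodule.mul_le.mpr fun a ha b hb => by
      obtain ⟨c, hc⟩ := hprod a ha b hb
      exact ⟨c, Ideal.subset_span ⟨a, ha, b, hb, hc.symm⟩, hc⟩
    obtain ⟨c, hc, hc1⟩ := hle (hmul.ge (one_le.mp le_rfl))
    have : c = 1 := FaithfulSMul.algebraMap_injective C B (by simpa using hc1)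
    exact (Ideal.eq_top_iff_one _).mpr (this ▸ hc)
  -- The products `a * b` generate the unit ideal, hence so do their `n`-th powers.
  have h1 : (1 : C) ∈ span C ((· ^ n) '' S) :=
    (Ideal.eq_top_iff_one _).mp (Ideal.span_pow_eq_top S hS n)
  obtain ⟨s, r, g, hr⟩ := mem_span_set'.mp h1
  choose c hcS hc using fun i => (g i).2
  choose a ha b hb hab using hcS
  have hr' : ∑ i, r i * (N (a i) * N (b i)) = 1 := by
    rw [← hr]
    exact Finset.sum_congr rfl fun i _ => by
      rw [hN _ (ha i) _ (hb i) _ (hab i), smul_eq_mul, ← hc i]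
  have hpow : ∀ i j, a i ^ n * b j ^ n = algebraMap C B (N (a i) * N (b j)) := by
    intro i j
    obtain ⟨e, he⟩ := hprod _ (ha i) _ (hb j)
    rw [hN _ (ha i) _ (hb j) e he.symm, map_pow, pow_mul_pow_of_mul_eq_algebraMap he.symm]
  -- Since `a i ^ n * b j ^ n = N (a i) * N (b j)` also for `i ≠ j`, the product `u * v` is the
  -- square of `∑ i, r i * (N (a i) * N (b i)) = 1`.
  let u := ∑ i, (r i * N (b i)) • a i ^ n
  let v := ∑ i, (r i * N (a i)) • b i ^ n
  have huv : u * v = 1 := by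
    have hij : ∀ i j, (r i * N (b i)) • a i ^ n * (r j * N (a j)) • b j ^ n =
        algebraMap C B (r i * (N (a i) * N (b i)) * (r j * (N (a j) * N (b j)))) := fun i j => by
      rw [smul_mul_smul_comm, hpow, Algebra.smul_def, ← map_mul]
      congr 1
      ring
    simp only [u, v, Finset.sum_mul_sum, hij, ← map_sum]
    rw [← Finset.sum_mul_sum, hr', one_mul, map_one]
  refine mem_Inn_of_isUnit_mem_twistedCenter
    ⟨⟨u, v, huv, mul_eq_one_symm_of_finite (C := C) huv⟩, rfl⟩ ?_
  change u ∈ _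
  exact sum_mem fun i _ => smul_mem _ _ (pow_mem_twistedCenter (ha i) n)

end Torsion

/-! ### The norm on one block -/

section DimensionVector

variable {C : Type*} {B : Type*} [CommRing C] [Algebra ℂ C] [Ring B] [Algebra C B]
  [Algebra ℂ B] [IsScalarTower ℂ C B] [IsAzumaya C B] {k : ℕ}

theorem pow_mem_Inn_of_fixes {d : Fin k → ℕ} (hd : ∀ i, 0 < d i) {ι : (Fin k → ℂ) →ₐ[ℂ] B}
    (hB : HasDimensionVector C B d ι) {ψ : B ≃ₐ[C] B} (hψ : ∀ z, ψ (ι z) = ι z) (i : Fin k) :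
    ψ ^ d i ∈ Inn C B := by
  obtain ⟨D, _, _, -, hD, f, hf⟩ := hB
  have hinj : Function.Injective (algebraMap C D) := FaithfulSMul.algebraMap_injective C D
  let _ : Algebra ℚ C := ((algebraMap ℂ C).comp (algebraMap ℚ ℂ)).toAlgebra
  have : Nonempty (Σ i, Fin (d i)) := ⟨⟨i, 0, hd i⟩⟩
  choose nrd hnrd using fun b => det_mem_range f b
  set e : B := ι (Pi.single i 1) with he
  have he2 : e * e = e := by rw [he, ← map_mul, ← Pi.single_mul, one_mul]
  have hcomm : ∀ {φ : B ≃ₐ[C] B}, φ e = e → ∀ a ∈ twistedCenter φ, a * e = e * a :=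
    fun {φ} h a ha => by simpa [h] using ha e
  -- Adding `1 - e` puts the identity on the other blocks, so the full reduced norm computes the
  -- determinant of block `i` alone.
  refine pow_mem_Inn_of_norm ψ (d i) (fun a => nrd (e * a + (1 - e))) fun a ha b hb c hc => ?_
  have hae := hcomm (hψ _) a ha
  have hbe := hcomm (ψ.symm_apply_eq.mpr (hψ _).symm : ψ⁻¹ e = e) b hb
  have hmul : (e * a + (1 - e)) * (e * b + (1 - e)) = c • e + (1 - e) := by
    have h1 : e * a * (e * b) = c • e := by
      rw [mul_assoc, ← mul_assoc a, hae, mul_assoc e a, hc, ← mul_assoc, he2, Algebra.smul_def,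
        Algebra.commutes]
    have h2 : e * a * (1 - e) = 0 := by
      rw [mul_assoc, mul_sub, mul_one, hae, mul_sub, ← mul_assoc, he2, sub_self]
    have h3 : (1 - e) * (e * b) = 0 := by
      rw [← mul_assoc, sub_mul, one_mul, he2, sub_self, zero_mul]
    have h4 : (1 - e) * (1 - e) = 1 - e := by
      rw [sub_mul, one_mul, mul_sub, mul_one, he2, sub_self, sub_zero]
    rw [add_mul, mul_add, mul_add, h1, h2, h3, h4, add_zero, zero_add]
  apply hinj
  rw [map_mul, hnrd, hnrd, ← Matrix.det_mul, ← map_mul, Algebra.TensorProduct.tmul_mul_tmul,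
    one_mul, hmul]
  have hdiag : f (1 ⊗ₜ[C] (c • e + (1 - e))) = Matrix.diagonal
      fun p : Σ i, Fin (d i) => if p.1 = i then algebraMap C D c else 1 := by
    have h1 : f (1 ⊗ₜ[C] (1 : B)) = 1 := map_one f
    rw [TensorProduct.tmul_add, TensorProduct.tmul_sub, TensorProduct.tmul_smul,
      ← algebraMap_smul D c, map_add, map_sub, map_smul, h1, he, hf, ← Matrix.diagonal_one,
      ← Matrix.diagonal_smul, Matrix.diagonal_sub, Matrix.diagonal_add]
    congr 1
    ext p
    by_cases h : p.1 = i <;> simp [h]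
  rw [hdiag, Matrix.det_diagonal, Fintype.prod_sigma, map_pow, Finset.prod_eq_single i]
  · simp
  · intro j _ hj
    simp [hj]
  · simp

end DimensionVector

end AzumayaDim

theorem mainTheorem6 {C : Type*} {B : Type*} [CommRing C] [Algebra ℂ C] [Ring B] [Algebra C B]
    [Algebra ℂ B] [IsScalarTower ℂ C B] [IsAzumaya C B] {k : ℕ} (d : Fin k → ℕ)
    (hd : ∀ i, 0 < d i) (ι : (Fin k → ℂ) →ₐ[ℂ] B)
    (hB : AzumayaDim.HasDimensionVector C B d ι) :
    (∃ Φ : AzumayaDim.Out C B →* CommRing.Pic C, Function.Injective Φ ∧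
      ∀ φ : B ≃ₐ[C] B, Nonempty
        ((Φ (QuotientGroup.mk φ) : CommRing.Pic C) ≃ₗ[C] AzumayaDim.twistedCenter φ)) ∧
    ∀ ψ : B ≃ₐ[C] B, (∀ z : Fin k → ℂ, ψ (ι z) = ι z) →
      orderOf (QuotientGroup.mk ψ : AzumayaDim.Out C B) ∣ Finset.univ.gcd d ∧
      (Finset.univ.gcd d = 1 → ∃ w : Bˣ, ∀ b : B, ψ b = w * b * (w⁻¹ : Bˣ)) := by
  refine ⟨⟨AzumayaDim.outToPic C B, AzumayaDim.outToPic_injective, fun φ =>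
    ⟨Submodule.unitsToPicEquiv (AzumayaDim.twistedCenterUnit φ)⟩⟩, fun ψ hψ => ?_⟩
  have hdvd : orderOf (QuotientGroup.mk ψ : AzumayaDim.Out C B) ∣ Finset.univ.gcd d :=
    Finset.dvd_gcd fun i _ => orderOf_dvd_of_pow_eq_one <| by
      rw [← QuotientGroup.mk_pow, QuotientGroup.eq_one_iff]
      exact AzumayaDim.pow_mem_Inn_of_fixes hd hB hψ i
  refine ⟨hdvd, fun h => ?_⟩
  rw [h, Nat.dvd_one, orderOf_eq_one_iff, QuotientGroup.eq_one_iff] at hdvd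
  obtain ⟨w, rfl⟩ := hdvd
  exact ⟨w, AzumayaDim.conjHom_apply C B w⟩
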